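/- Let $d\ge 0$ be an integer and let $A,B\subset\mathbb{R}^d$ be finite sets with $|A|=m$. Assume that $B$ is proper $d$-dimensional, that is, not contained in any affine hyperplane of $\mathbb{R}^d$, and that $A\subset\operatorname{conv}B$, the convex hull of $B$. For a positive integer $k$ let $kB=B+\dots+B$ ($k$ summands) denote the $k$-fold sumset. Then for every positive integer $k$, $$|A+kB|\ \ge\ m\binom{d+k}{k}-k\binom{d+k}{k+1}=\left(m-\frac{kd}{k+1}\right)\binom{d+k}{k}.$$ -/

import Mathlib

open scoped Pointwise

/-- An affine hyperplane: a level set of a nonzero linear functional. -/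
def IsAffineHyperplane {d : ℕ} (H : Set (EuclideanSpace ℝ (Fin d))) : Prop :=
  ∃ f : EuclideanSpace ℝ (Fin d) →ₗ[ℝ] ℝ, f ≠ 0 ∧ ∃ c : ℝ, H = {x | f x = c}

/-- A set in `ℝ^d` is proper `d`-dimensional if it is not contained in any affine hyperplane. -/
def IsProperDimensional {d : ℕ} (B : Set (EuclideanSpace ℝ (Fin d))) : Prop :=
  ∀ H : Set (EuclideanSpace ℝ (Fin d)), IsAffineHyperplane H → ¬ B ⊆ H

/-- The `k`-fold sumset `kB = B + ⋯ + B` (`k` summands; `{0}` for `k = 0`).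
This is not the dilation `{k b | b ∈ B}`. -/
def iteratedSumset {d : ℕ} (B : Set (EuclideanSpace ℝ (Fin d))) :
    ℕ → Set (EuclideanSpace ℝ (Fin d))
  | 0 => {0}
  | k + 1 => iteratedSumset B k + B

/-!
List the points of `B` as `p`, possibly with repetitions, starting with an affine basis of its span.
Representing every point of `conv B` by its convex combination of the `p i` that is least in the
colexicographic order triangulates `conv B`: the supports of least combinations are faces, and a
weight supported on a face is determined by the point it represents. As the colexicographic order
first minimises the weight of the last points, a face contained in an initial segment of `p`
extends, inside that segment, to a face with the same span as the segment.

Hence every point `a` of `A` lies in the convex hull of a face `T a` with at least `d + 1` vertices,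
except that for the `j`-th point of the affine basis (`j < d`) we choose a face of which it is the
last vertex, and this has at least `j + 1` vertices. The sums of `a` with `k` points of `T a` are
then pairwise distinct: uniqueness of weights on faces recovers the total weight of `a` and the `k`
points, and its fractional parts recover `a`. Now `T a` gives `(#(T a) + k - 1).choose k` sums, so
at most `∑ j < d, ((d + k).choose k - (j + k).choose k) = k * (d + k).choose (k + 1)` are missing
from `#A * (d + k).choose k`.
-/

open Filter Finset Topology

section Colex

variable {ι : Type*} [LinearOrder ι]

theorem exists_forall_toColex_le_of_isCompact [Finite ι] {α : Type*} [LinearOrder α]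
    [TopologicalSpace α] [OrderClosedTopology α] {K : Set (ι → α)} (hK : IsCompact K)
    (hne : K.Nonempty) : ∃ x ∈ K, ∀ y ∈ K, toColex x ≤ toColex y := by
  have := Fintype.ofFinite ι
  suffices h : ∀ s : Finset ι, ∃ x ∈ K, ∀ y ∈ K, (∀ i ∈ s, x i = y i) ∨
      ∃ i ∈ s, (∀ j ∈ s, i < j → x j = y j) ∧ x i < y i by
    obtain ⟨x, hx, hmin⟩ := h Finset.univ
    refine ⟨x, hx, fun y hy => (hmin y hy).elim (fun h => ?_) fun ⟨i, _, heq, hlt⟩ => ?_⟩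
    · exact (congrArg toColex (funext fun i => h i (Finset.mem_univ i))).le
    · exact le_of_lt (⟨i, fun j hj => heq j (Finset.mem_univ j) hj, hlt⟩ : toColex x < toColex y)
  intro s
  induction s using Finset.induction_on_min with
  | empty =>
    obtain ⟨x, hx⟩ := hne
    exact ⟨x, hx, fun y _ => Or.inl fun i hi => absurd hi (Finset.notMem_empty i)⟩
  | insert a s ha ih =>
    obtain ⟨x, hx, hmin⟩ := ih
    have hslice : IsClosed {y : ι → α | ∀ i ∈ s, x i = y i} := by
      simp only [Set.ofPred_forall]
      exact isClosed_biInter fun i _ => isClosed_eq continuous_const (continuous_apply i)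
    obtain ⟨z, ⟨hzK, hzx⟩, hz⟩ := (hK.inter_right hslice).exists_isMinOn ⟨x, hx, fun _ _ => rfl⟩
      (continuous_apply a).continuousOn
    refine ⟨z, hzK, fun y hy => ?_⟩
    rcases hmin y hy with heq | ⟨i, hi, heq, hlt⟩
    · have hzy : ∀ i ∈ s, z i = y i := fun i hi => (hzx i hi).symm.trans (heq i hi)
      rcases (hz ⟨hy, heq⟩ : z a ≤ y a).eq_or_lt with hay | hay
      · exact Or.inl (Finset.forall_mem_insert _ _ _ |>.2 ⟨hay, hzy⟩)
      · refine Or.inr ⟨a, Finset.mem_insert_self a s, fun j hj haj => ?_, hay⟩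
        exact hzy j (Finset.mem_of_mem_insert_of_ne hj haj.ne')
    · refine Or.inr ⟨i, Finset.mem_insert_of_mem hi, fun j hj hij => ?_, hzx i hi ▸ hlt⟩
      have hjs := Finset.mem_of_mem_insert_of_ne hj ((ha i hi).trans hij).ne'
      exact (hzx j hjs).symm.trans (heq j hjs hij)

theorem toColex_add_smul_sub_lt {R : Type*} [Ring R] [LinearOrder R] [IsStrictOrderedRing R]
    {x y z : ι → R} {ε : R} (hε : 0 < ε) (h : toColex x < toColex y) :
    toColex (z + ε • (x - y)) < toColex z := by
  obtain ⟨i, heq, hlt⟩ := h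
  refine ⟨i, fun j hj => ?_, ?_⟩
  · have : x j = y j := heq j hj
    simp [this]
  · have : x i < y i := hlt
    simpa using mul_neg_of_pos_of_neg hε (sub_neg.2 this)

theorem support_subset_of_toColex_le {R : Type*} [Zero R] [PartialOrder R] {s : Set ι}
    (hs : IsLowerSet s) {x y : ι → R} (hx : 0 ≤ x) (hxy : toColex x ≤ toColex y)
    (hy : Function.support y ⊆ s) : Function.support x ⊆ s := by
  rcases eq_or_lt_of_le hxy with hxy | ⟨i, heq, hlt⟩
  · rwa [toColex_inj.1 hxy]
  intro j hj
  rcases lt_or_ge i j with hij | hij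
  · exact hy fun hyj => hj ((heq j hij).trans hyj)
  · exact hs hij (hy ((hx i).trans_lt hlt).ne')

end Colex

theorem isClosed_preimage_image_of_isCompact {𝕜 V W : Type*} [NontriviallyNormedField 𝕜]
    [CompleteSpace 𝕜] [AddCommGroup V] [TopologicalSpace V] [IsTopologicalAddGroup V] [T2Space V]
    [Module 𝕜 V] [ContinuousSMul 𝕜 V] [FiniteDimensional 𝕜 V] [AddCommGroup W] [Module 𝕜 W]
    (L : V →ₗ[𝕜] W) {K : Set V} (hK : IsCompact K) :
    IsClosed (L ⁻¹' (L '' K)) := by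
  rw [show L ⁻¹' (L '' K) = K + (LinearMap.ker L : Set V) from ?_]
  · exact (Submodule.closed_of_finiteDimensional _).add_left_of_isCompact hK
  ext x
  simp only [Set.mem_preimage, Set.mem_image, Set.mem_add, SetLike.mem_coe, LinearMap.mem_ker]
  constructor
  · rintro ⟨y, hy, hxy⟩
    exact ⟨y, hy, x - y, by rw [map_sub, hxy, sub_self], add_sub_cancel y x⟩
  · rintro ⟨y, hy, z, hz, rfl⟩
    exact ⟨y, hy, by rw [map_add, hz, add_zero]⟩

theorem linearCombination_mem_span_image {ι R M : Type*} [Fintype ι] [Semiring R]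
    [AddCommMonoid M] [Module R M] {q : ι → M} {l : ι → R} {s : Set ι}
    (hl : Function.support l ⊆ s) :
    Fintype.linearCombination R q l ∈ Submodule.span R (q '' s) := by
  rw [Fintype.linearCombination_apply]
  refine Submodule.sum_mem _ fun i _ => ?_
  by_cases hi : l i = 0
  · simp [hi]
  · exact Submodule.smul_mem _ _ (Submodule.subset_span ⟨i, hl hi, rfl⟩)

section Weights

variable {ι F : Type*} [Fintype ι] [AddCommGroup F] [Module ℝ F] {q : ι → F}

theorem isCompact_nonneg_weights {φ : F →ₗ[ℝ] ℝ} (hφ : ∀ i, 0 < φ (q i)) (r : ℝ) :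
    IsCompact {l : ι → ℝ | 0 ≤ l ∧ φ (Fintype.linearCombination ℝ q l) ≤ r} := by
  have hcont : Continuous (φ ∘ₗ Fintype.linearCombination ℝ q) :=
    LinearMap.continuous_of_finiteDimensional _
  refine (isCompact_Icc (a := 0) (b := fun i => r / φ (q i))).of_isClosed_subset
    ((isClosed_le continuous_const continuous_id).inter (isClosed_le hcont continuous_const)) ?_
  refine fun l ⟨hl, hr⟩ => ⟨hl, fun i => (le_div_iff₀ (hφ i)).2 (le_trans ?_ hr)⟩
  rw [Fintype.linearCombination_apply, map_sum]
  simp only [map_smul, smul_eq_mul]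
  exact Finset.single_le_sum (f := fun i => l i * φ (q i))
    (fun j _ => mul_nonneg (hl j) (hφ j).le) (Finset.mem_univ i)

theorem isClosed_setOf_exists_weight {φ : F →ₗ[ℝ] ℝ} (hφ : ∀ i, 0 < φ (q i)) (τ : Set ι) :
    IsClosed {x : ι → ℝ | ∃ l, 0 ≤ l ∧ Function.support l ⊆ τ ∧
      Fintype.linearCombination ℝ q l = Fintype.linearCombination ℝ q x} := by
  set L := Fintype.linearCombination ℝ q
  refine isClosed_of_closure_subset fun x hx => ?_
  have hτ : IsClosed {l : ι → ℝ | Function.support l ⊆ τ} := by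
    simp only [Function.support_subset_iff', Set.ofPred_forall]
    exact isClosed_biInter fun i _ => isClosed_eq (continuous_apply i) continuous_const
  have hcont : Continuous (φ ∘ₗ L) := LinearMap.continuous_of_finiteDimensional _
  have hnear : ∀ᶠ y in 𝓝 x, φ (L y) ≤ φ (L x) + 1 :=
    ((hcont.tendsto x).eventually_lt_const (lt_add_one _)).mono fun _ => le_of_lt
  have hclosed := isClosed_preimage_image_of_isCompact L
    ((isCompact_nonneg_weights hφ (φ (L x) + 1)).inter_right hτ)
  obtain ⟨l, ⟨⟨hl, -⟩, hlτ⟩, hL⟩ := hclosed.mem_of_frequently_of_tendsto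
    (((mem_closure_iff_frequently.1 hx).and_eventually hnear).mono
      fun y ⟨⟨l, hl, hlτ, hL⟩, hy⟩ => ⟨l, ⟨⟨hl, hL ▸ hy⟩, hlτ⟩, hL⟩) tendsto_id
  exact ⟨l, hl, hlτ, hL⟩

end Weights

section Face

variable {ι F : Type*} [LinearOrder ι] [Fintype ι] [AddCommGroup F] [Module ℝ F] {q : ι → F}

/-- A weight `l ≥ 0` is colex-least for `q` if it comes first in the colexicographic order among the
weights `l' ≥ 0` representing the same vector `∑ i, l i • q i`. -/
def IsColexLeast (q : ι → F) (l : ι → ℝ) : Prop :=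
  0 ≤ l ∧ ∀ l', 0 ≤ l' → Fintype.linearCombination ℝ q l' = Fintype.linearCombination ℝ q l →
    toColex l ≤ toColex l'

/-- Faces of the triangulation of the cone spanned by `q` in which every vector is represented by
its colex-least weight; a face is recorded as the set of indices of its generators. -/
def IsFace (q : ι → F) (σ : Set ι) : Prop :=
  ∀ l, 0 ≤ l → Function.support l ⊆ σ → IsColexLeast q l

theorem exists_isColexLeast {φ : F →ₗ[ℝ] ℝ} (hφ : ∀ i, 0 < φ (q i)) {l : ι → ℝ} (hl : 0 ≤ l) :
    ∃ l', IsColexLeast q l' ∧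
      Fintype.linearCombination ℝ q l' = Fintype.linearCombination ℝ q l := by
  set L := Fintype.linearCombination ℝ q
  have hclosed : IsClosed (L ⁻¹' {L l}) := by
    simpa only [Set.image_singleton] using
      isClosed_preimage_image_of_isCompact L (isCompact_singleton (x := l))
  obtain ⟨m, ⟨⟨hm, -⟩, hmL⟩, hmin⟩ := exists_forall_toColex_le_of_isCompact
    ((isCompact_nonneg_weights hφ (φ (L l))).inter_right hclosed) ⟨l, ⟨hl, le_rfl⟩, rfl⟩
  refine ⟨m, ⟨hm, fun l' hl' hL => ?_⟩, hmL⟩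
  have hL' : L l' = L l := hL.trans hmL
  exact hmin l' ⟨⟨hl', hL' ▸ le_rfl⟩, hL'⟩

theorem IsColexLeast.eq {l l' : ι → ℝ} (hl : IsColexLeast q l) (hl' : IsColexLeast q l')
    (h : Fintype.linearCombination ℝ q l = Fintype.linearCombination ℝ q l') : l = l' :=
  toColex_inj.1 ((hl.2 l' hl'.1 h.symm).antisymm (hl'.2 l hl.1 h))

-- A weight `l''` preceding `l'` with the same value would make `l + ε • (l'' - l')` precede `l`.
theorem IsColexLeast.isFace_support {l : ι → ℝ} (hl : IsColexLeast q l) :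
    IsFace q (Function.support l) := by
  refine fun l' hl' hsupp => ⟨hl', fun l'' hl'' hL => ?_⟩
  by_contra hle
  have hlt := not_le.1 hle
  obtain ⟨ε, hε, hεl⟩ : ∃ ε > (0 : ℝ), ∀ i, ε * l' i ≤ l i := by
    have hev : ∀ i, ∀ᶠ ε in 𝓝[>] (0 : ℝ), ε * l' i ≤ l i := by
      intro i
      by_cases hi : l i = 0
      · have : l' i = 0 := by_contra fun h => hsupp h hi
        simp [hi, this]
      · have hlim : Tendsto (fun ε : ℝ => ε * l' i) (𝓝[>] 0) (𝓝 0) :=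
          ((continuous_mul_const (l' i)).tendsto' 0 0 (zero_mul _)).mono_left nhdsWithin_le_nhds
        exact (hlim.eventually_lt_const ((hl.1 i).lt_of_ne' hi)).mono fun _ => le_of_lt
    exact ((eventually_mem_nhdsWithin (s := Set.Ioi (0 : ℝ))).and (eventually_all.2 hev)).exists
  refine (hl.2 (l + ε • (l'' - l')) (fun i => ?_) ?_).not_gt (toColex_add_smul_sub_lt hε hlt)
  · have := mul_nonneg hε.le (hl'' i)
    simp only [Pi.zero_apply, Pi.add_apply, Pi.smul_apply, Pi.sub_apply, smul_eq_mul]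
    linarith [hεl i]
  · rw [map_add, map_smul, map_sub, hL, sub_self, smul_zero, add_zero]

theorem exists_isFace_support {φ : F →ₗ[ℝ] ℝ} (hφ : ∀ i, 0 < φ (q i)) {s : Set ι}
    (hs : IsLowerSet s) {l : ι → ℝ} (hl : 0 ≤ l) (hls : Function.support l ⊆ s) :
    ∃ l', 0 ≤ l' ∧ Fintype.linearCombination ℝ q l' = Fintype.linearCombination ℝ q l ∧
      Function.support l' ⊆ s ∧ IsFace q (Function.support l') := by
  obtain ⟨l', hl', hL⟩ := exists_isColexLeast hφ hl
  exact ⟨l', hl'.1, hL, support_subset_of_toColex_le hs hl'.1 (hl'.2 l hl hL.symm) hls,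
    hl'.isFace_support⟩

-- Move slightly from the barycentre of `σ` towards `q v`: one of the finitely many faces is met
-- arbitrarily close to the barycentre, hence contains it.
theorem IsFace.exists_superset_mem_span {φ : F →ₗ[ℝ] ℝ} (hφ : ∀ i, 0 < φ (q i)) {σ s : Set ι}
    (hσ : IsFace q σ) (hs : IsLowerSet s) (hσs : σ ⊆ s) {v : ι} (hv : v ∈ s) :
    ∃ τ, IsFace q τ ∧ σ ⊆ τ ∧ τ ⊆ s ∧ q v ∈ Submodule.span ℝ (q '' τ) := by
  classical
  set L := Fintype.linearCombination ℝ q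
  set c : ι → ℝ := σ.indicator 1
  have hc : 0 ≤ c := Set.indicator_nonneg fun _ _ => zero_le_one
  have hcσ : Function.support c ⊆ σ := Set.support_indicator_subset
  have hLp : ∀ ε : ℝ, L (c + Pi.single v ε) = L c + ε • q v := by simp [L]
  have hcover : ∀ ε > 0, ∃ τ, 0 < ε ∧ (IsFace q τ ∧ τ ⊆ s) ∧
      ∃ l, 0 ≤ l ∧ Function.support l ⊆ τ ∧ L l = L (c + Pi.single v ε) := by
    intro ε hε
    have hsupp : Function.support (c + Pi.single v ε) ⊆ s :=
      (Function.support_add _ _).trans (Set.union_subset (hcσ.trans hσs)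
        (Pi.support_single_subset.trans (Set.singleton_subset_iff.2 hv)))
    obtain ⟨l, hl, hL, hls, hface⟩ :=
      exists_isFace_support hφ hs (add_nonneg hc (Pi.single_nonneg.2 hε.le)) hsupp
    exact ⟨_, hε, ⟨hface, hls⟩, l, hl, subset_rfl, hL⟩
  obtain ⟨τ, hτ⟩ := frequently_exists.1
    ((eventually_mem_nhdsWithin (a := (0 : ℝ)) (s := Set.Ioi 0)).mono hcover).frequently
  obtain ⟨m, hm, hmτ, hmL⟩ : ∃ m, 0 ≤ m ∧ Function.support m ⊆ τ ∧ L m = L c := by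
    have hlim : Tendsto (fun ε : ℝ => c + Pi.single v ε) (𝓝[>] 0) (𝓝 (c + Pi.single v 0)) :=
      (continuous_const.add (continuous_single v)).continuousWithinAt
    rw [Pi.single_zero, add_zero] at hlim
    exact (isClosed_setOf_exists_weight hφ τ).mem_of_frequently_of_tendsto
      (hτ.mono fun _ h => h.2.2) hlim
  obtain ⟨ε, ⟨hε, ⟨hface, hτs⟩, l, -, hlτ, hL⟩⟩ := hτ.exists
  have hcτ : Function.support c ⊆ τ := (hface m hm hmτ).eq (hσ c hc hcσ) hmL ▸ hmτ
  refine ⟨τ, hface, ?_, hτs, ?_⟩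
  · simpa [c, Set.support_indicator] using hcτ
  · have hspan : ε • q v ∈ Submodule.span ℝ (q '' τ) := by
      rw [show ε • q v = L l - L c by rw [hL, hLp, add_sub_cancel_left]]
      exact sub_mem (linearCombination_mem_span_image hlτ) (linearCombination_mem_span_image hcτ)
    exact (Submodule.smul_mem_iff _ hε.ne').1 hspan

theorem IsFace.exists_superset_image_subset_span {φ : F →ₗ[ℝ] ℝ} (hφ : ∀ i, 0 < φ (q i))
    {σ s : Set ι} (hσ : IsFace q σ) (hs : IsLowerSet s) (hσs : σ ⊆ s) :
    ∃ τ, IsFace q τ ∧ σ ⊆ τ ∧ τ ⊆ s ∧ q '' s ⊆ Submodule.span ℝ (q '' τ) := by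
  obtain ⟨τ, hστ, hτ⟩ :=
    (Set.toFinite {τ | IsFace q τ ∧ τ ⊆ s}).exists_le_maximal (a := σ) ⟨hσ, hσs⟩
  refine ⟨τ, hτ.prop.1, hστ, hτ.prop.2, ?_⟩
  rintro _ ⟨v, hv, rfl⟩
  obtain ⟨τ', hτ', hle, hτ's, hspan⟩ := hτ.prop.1.exists_superset_mem_span hφ hs hτ.prop.2 hv
  rwa [hτ.eq_of_subset ⟨hτ', hτ's⟩ hle]

theorem IsFace.exists_superset_card_le {φ : F →ₗ[ℝ] ℝ} (hφ : ∀ i, 0 < φ (q i)) {σ s : Set ι}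
    (hσ : IsFace q σ) (hs : IsLowerSet s) (hσs : σ ⊆ s) {t : Finset ι}
    (ht : LinearIndepOn ℝ q (t : Set ι)) (hts : (t : Set ι) ⊆ s) :
    ∃ τ : Finset ι, IsFace q τ ∧ σ ⊆ τ ∧ (τ : Set ι) ⊆ s ∧ #t ≤ #τ := by
  obtain ⟨τ, hτ, hστ, hτs, hspan⟩ := hσ.exists_superset_image_subset_span hφ hs hσs
  obtain ⟨τ, rfl⟩ := τ.toFinite.exists_finset_coe
  refine ⟨τ, hτ, hστ, hτs, ?_⟩
  classical
  have hrange : Set.range (fun i : t => q i) ⊆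
      Submodule.span ℝ ((τ.image q : Finset F) : Set F) := by
    rw [Finset.coe_image]
    rintro _ ⟨i, rfl⟩
    exact hspan ⟨i, hts i.2, rfl⟩
  have hcard := linearIndependent_le_span_aux' (fun i : t => q i) ht _ hrange
  simp only [Finset.coe_sort_coe, Fintype.card_coe] at hcard
  exact hcard.trans Finset.card_image_le

end Face

theorem convexHull_range_eq_image_stdSimplex {ι E : Type*} [Fintype ι] [AddCommGroup E]
    [Module ℝ E] (p : ι → E) :
    convexHull ℝ (Set.range p) = Fintype.linearCombination ℝ p '' stdSimplex ℝ ι := by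
  classical
  rw [← convexHull_rangle_single_eq_stdSimplex, LinearMap.image_convexHull, ← Set.range_comp]
  congr 2
  ext i
  simp

theorem eq_single_of_one_le {ι : Type*} [Fintype ι] [DecidableEq ι] {l : ι → ℝ}
    (hl : l ∈ stdSimplex ℝ ι) {i : ι} (hi : 1 ≤ l i) : l = Pi.single i 1 := by
  have hsum := (Finset.add_sum_erase _ l (Finset.mem_univ i)).trans hl.2
  have hnonneg : 0 ≤ ∑ j ∈ Finset.univ.erase i, l j := Finset.sum_nonneg fun j _ => hl.1 j
  have hzero := (Finset.sum_eq_zero_iff_of_nonneg fun j _ => hl.1 j).1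
    (by linarith : ∑ j ∈ Finset.univ.erase i, l j = 0)
  funext j
  rcases eq_or_ne j i with rfl | hj
  · rw [Pi.single_eq_same]
    linarith
  · rw [hzero j (Finset.mem_erase.2 ⟨hj, Finset.mem_univ j⟩), Pi.single_eq_of_ne hj]

theorem exists_one_le_of_fract_eq_fract_single {ι : Type*} [Fintype ι] [DecidableEq ι] {l : ι → ℝ}
    (hl : l ∈ stdSimplex ℝ ι) {j : ι}
    (h : ∀ i, Int.fract (l i) = Int.fract ((Pi.single j 1 : ι → ℝ) i)) : ∃ i, 1 ≤ l i := by
  by_contra! hlt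
  have hzero : ∀ i, l i = 0 := fun i => by
    rw [← Int.fract_eq_self.2 ⟨hl.1 i, hlt i⟩, h, Pi.single_apply]
    split_ifs <;> simp
  simpa [hzero] using hl.2

theorem mem_support_of_single_add_eq {ι : Type*} [DecidableEq ι] {i j : ι} {N N' : ι →₀ ℕ}
    (hij : j ≠ i)
    (h : ∀ x, (Pi.single i 1 : ι → ℝ) x + N x = (Pi.single j 1 : ι → ℝ) x + N' x) :
    j ∈ N.support := by
  have hj := h j
  rw [Pi.single_eq_of_ne hij, Pi.single_eq_same, zero_add] at hj
  rw [Finsupp.mem_support_iff, ← Nat.cast_ne_zero (R := ℝ), hj]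
  positivity

theorem sum_eq_of_mem_finsuppAntidiag {ι : Type*} [Fintype ι] [DecidableEq ι] {T : Finset ι}
    {k : ℕ} {N : ι →₀ ℕ} (hN : N ∈ T.finsuppAntidiag k) : ∑ i, N i = k := by
  obtain ⟨hsum, hsupp⟩ := mem_finsuppAntidiag.1 hN
  rw [← hsum]
  exact (Finset.sum_subset (Finset.subset_univ T) fun i _ hi =>
    Finsupp.notMem_support_iff.1 fun h => hi (hsupp h)).symm

section PointConfiguration

variable {ι E : Type*} [AddCommGroup E] [Module ℝ E]

/-- The lift of a point configuration to height `1`, turning convex combinations of the points `p i`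
into nonnegative combinations of the vectors `(1, p i)`. -/
def homogenization (p : ι → E) (i : ι) : ℝ × E :=
  (1, p i)

variable {p : ι → E}

theorem linearIndependent_homogenization (hp : AffineIndependent ℝ p) :
    LinearIndependent ℝ (homogenization p) := by
  rw [linearIndependent_iff']
  intro s w hw
  have hw' := Prod.ext_iff.1 hw
  simp only [homogenization, Prod.fst_sum, Prod.snd_sum, Prod.smul_mk, smul_eq_mul, mul_one,
    Prod.fst_zero, Prod.snd_zero] at hw'
  exact affineIndependent_iff.1 hp s w hw'.1 hw'.2

variable [Fintype ι]

theorem linearCombination_homogenization (p : ι → E) (l : ι → ℝ) :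
    Fintype.linearCombination ℝ (homogenization p) l =
      (∑ i, l i, Fintype.linearCombination ℝ p l) := by
  simp [Fintype.linearCombination_apply, homogenization, Prod.ext_iff, Prod.fst_sum, Prod.snd_sum]

variable [LinearOrder ι]

/-- A carrier of the point `a`: a face `T` together with convex weights `l` on `T` representing `a`.
An entry of `l` may equal `1` only at the last index of `T`: this prevents `p i + p j` from
arising both as `a = p i` plus a vertex of its face and as `a = p j` plus a vertex of its face. -/
structure IsCarrier (p : ι → E) (a : E) (l : ι → ℝ) (T : Finset ι) : Prop where
  mem_stdSimplex : l ∈ stdSimplex ℝ ι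
  linearCombination_eq : Fintype.linearCombination ℝ p l = a
  support_subset : Function.support l ⊆ T
  isFace : IsFace (homogenization p) T
  lt_one_or_eq_single : (∀ i, l i < 1) ∨ ∃ i, l = Pi.single i 1 ∧ ∀ j ∈ T, j ≤ i

theorem exists_isCarrier [LocallyFiniteOrderBot ι] {m : ι}
    (hm : AffineIndependent ℝ fun i : Set.Iic m => p i) {a : E}
    (ha : a ∈ convexHull ℝ (Set.range p)) :
    ∃ l T u, IsCarrier p a l T ∧ #(Finset.Iic (min u m)) ≤ #T ∧ (u < m → p u = a) := by
  have hφ : ∀ i, 0 < LinearMap.fst ℝ ℝ E (homogenization p i) := fun _ => zero_lt_one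
  have hindep : LinearIndepOn ℝ (homogenization p) (Set.Iic m) :=
    linearIndependent_homogenization hm
  rw [convexHull_range_eq_image_stdSimplex] at ha
  obtain ⟨l₀, ⟨hl₀, hsum₀⟩, rfl⟩ := ha
  obtain ⟨l, hl, hL⟩ := exists_isColexLeast hφ (l := l₀) hl₀
  rw [linearCombination_homogenization, linearCombination_homogenization, Prod.mk_inj] at hL
  have hsimplex : l ∈ stdSimplex ℝ ι := ⟨hl.1, hL.1.trans hsum₀⟩
  by_cases hvertex : ∃ i, 1 ≤ l i
  · obtain ⟨i, hi⟩ := hvertex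
    obtain rfl := eq_single_of_one_le hsimplex hi
    have hsupp : Function.support (Pi.single i (1 : ℝ)) ⊆ Set.Iic i :=
      Pi.support_single_subset.trans (Set.singleton_subset_iff.2 le_rfl)
    obtain ⟨T, hT, hiT, hTi, hcard⟩ := hl.isFace_support.exists_superset_card_le hφ
      (isLowerSet_Iic i) hsupp (t := Finset.Iic (min i m))
      (hindep.mono (by simp)) (by simp)
    refine ⟨_, T, i, ⟨hsimplex, hL.2, hiT, hT, Or.inr ⟨i, rfl, hTi⟩⟩, hcard, fun _ => ?_⟩
    rw [← hL.2, Fintype.linearCombination_apply_single, one_smul]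
  · push Not at hvertex
    obtain ⟨T, hT, hlT, -, hcard⟩ := hl.isFace_support.exists_superset_card_le hφ
      isLowerSet_univ (Set.subset_univ _) (t := Finset.Iic m) (by simpa using hindep)
      (Set.subset_univ _)
    exact ⟨l, T, m, ⟨hsimplex, hL.2, hlT, hT, Or.inl hvertex⟩, by rwa [min_self],
      fun h => absurd h (lt_irrefl m)⟩

variable {a a' : E} {l l' : ι → ℝ} {T T' : Finset ι}

theorem IsCarrier.weight_eq_of_add_eq (h : IsCarrier p a l T) (h' : IsCarrier p a' l' T')
    {N N' : ι →₀ ℕ} (hN : N.support ⊆ T) (hN' : N'.support ⊆ T')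
    (heq : ∀ i, l i + N i = l' i + N' i) : l = l' := by
  have hfract : ∀ i, Int.fract (l i) = Int.fract (l' i) := fun i => by
    simpa only [Int.fract_add_natCast] using congrArg Int.fract (heq i)
  rcases h.lt_one_or_eq_single with hlt | ⟨i, rfl, hi⟩ <;>
    rcases h'.lt_one_or_eq_single with hlt' | ⟨j, rfl, hj⟩
  · funext i
    rw [← Int.fract_eq_self.2 ⟨h.mem_stdSimplex.1 i, hlt i⟩, hfract,
      Int.fract_eq_self.2 ⟨h'.mem_stdSimplex.1 i, hlt' i⟩]
  · obtain ⟨i, hi⟩ := exists_one_le_of_fract_eq_fract_single h.mem_stdSimplex hfract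
    exact absurd (hlt i) hi.not_gt
  · obtain ⟨j, hj⟩ := exists_one_le_of_fract_eq_fract_single h'.mem_stdSimplex
      fun x => (hfract x).symm
    exact absurd (hlt' j) hj.not_gt
  · by_contra hij
    have hij : i ≠ j := fun h => hij (h ▸ rfl)
    exact hij ((hj i (hN' (mem_support_of_single_add_eq hij fun x => (heq x).symm))).antisymm
      (hi j (hN (mem_support_of_single_add_eq hij.symm heq))))

theorem IsCarrier.isColexLeast_add (h : IsCarrier p a l T) {N : ι →₀ ℕ} (hN : N.support ⊆ T) :
    IsColexLeast (homogenization p) (fun i => l i + N i) :=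
  h.isFace _ (fun i => add_nonneg (h.mem_stdSimplex.1 i) (Nat.cast_nonneg _))
    ((Function.support_add _ _).trans (Set.union_subset h.support_subset fun _ hi =>
      hN (Finsupp.mem_support_iff.2 (Nat.cast_ne_zero.1 hi))))

theorem IsCarrier.linearCombination_homogenization_add (h : IsCarrier p a l T) {N : ι →₀ ℕ} {k : ℕ}
    (hN : N ∈ T.finsuppAntidiag k) :
    Fintype.linearCombination ℝ (homogenization p) (fun i => l i + N i) =
      (1 + (k : ℝ), a + ∑ i, N i • p i) := by
  have hl := h.linearCombination_eq
  rw [Fintype.linearCombination_apply] at hl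
  rw [linearCombination_homogenization, Fintype.linearCombination_apply]
  simp only [add_smul, Finset.sum_add_distrib, h.mem_stdSimplex.2, hl, Nat.cast_smul_eq_nsmul,
    ← Nat.cast_sum, sum_eq_of_mem_finsuppAntidiag hN]

theorem IsCarrier.eq_of_add_eq (h : IsCarrier p a l T) (h' : IsCarrier p a' l' T')
    {N N' : ι →₀ ℕ} {k : ℕ} (hN : N ∈ T.finsuppAntidiag k) (hN' : N' ∈ T'.finsuppAntidiag k)
    (heq : a + ∑ i, N i • p i = a' + ∑ i, N' i • p i) : a = a' ∧ N = N' := by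
  have hNT := (mem_finsuppAntidiag.1 hN).2
  have hNT' := (mem_finsuppAntidiag.1 hN').2
  have hadd : (fun i => l i + (N i : ℝ)) = fun i => l' i + (N' i : ℝ) := by
    refine (h.isColexLeast_add hNT).eq (h'.isColexLeast_add hNT') ?_
    rw [h.linearCombination_homogenization_add hN, h'.linearCombination_homogenization_add hN', heq]
  obtain rfl := h.weight_eq_of_add_eq h' hNT hNT' (congrFun hadd)
  refine ⟨h.linearCombination_eq.symm.trans h'.linearCombination_eq, Finsupp.ext fun i => ?_⟩
  exact_mod_cast add_left_cancel (congrFun hadd i)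

end PointConfiguration

section Counting

theorem card_mul_le_sum_min_add {α : Type*} {A : Finset α} {d : ℕ} {f : ℕ → ℕ} (hf : Monotone f)
    {g : α → ℕ} (hg : Set.InjOn g {a ∈ A | g a < d}) :
    #A * f d ≤ ∑ a ∈ A, f (min (g a) d) + ∑ j ∈ range d, (f d - f j) := by
  have hle : ∀ a ∈ A, f d ≤ f (min (g a) d) + if g a < d then f d - f (g a) else 0 := by
    intro _ _
    split_ifs with h
    · rw [min_eq_left h.le, Nat.add_sub_cancel' (hf h.le)]
    · rw [min_eq_right (not_lt.1 h), add_zero]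
  calc #A * f d = ∑ _ ∈ A, f d := by rw [Finset.sum_const, smul_eq_mul]
    _ ≤ ∑ a ∈ A, (f (min (g a) d) + if g a < d then f d - f (g a) else 0) := Finset.sum_le_sum hle
    _ = ∑ a ∈ A, f (min (g a) d) + ∑ j ∈ image g {a ∈ A | g a < d}, (f d - f j) := by
      rw [Finset.sum_add_distrib, ← Finset.sum_filter, Finset.sum_image (by simpa using hg)]
    _ ≤ ∑ a ∈ A, f (min (g a) d) + ∑ j ∈ range d, (f d - f j) := by
      gcongr
      intro j hj
      obtain ⟨a, ha, rfl⟩ := Finset.mem_image.1 hj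
      exact Finset.mem_range.2 (Finset.mem_filter.1 ha).2

theorem sum_range_choose_sub_choose (d k : ℕ) :
    ∑ j ∈ range d, ((d + k).choose k - (j + k).choose k) = k * (d + k).choose (k + 1) := by
  have hsum : ∑ j ∈ range d, (j + k).choose k = (d + k).choose (k + 1) := by
    have h := Nat.sum_range_add_choose d k
    rw [Finset.sum_range_succ, Nat.choose_succ_succ'] at h
    omega
  have hmul := Nat.choose_succ_right_eq (d + k) k
  rw [Nat.add_sub_cancel] at hmul
  rw [Finset.sum_tsub_distrib _ fun j hj =>
    Nat.choose_le_choose k (Nat.add_le_add_right (Finset.mem_range.1 hj).le k), hsum,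
    Finset.sum_const, Finset.card_range, smul_eq_mul, mul_comm d, ← hmul, mul_add_one, mul_comm k,
    Nat.add_sub_cancel]

theorem finite_sum_const {E : Type*} [AddCommMonoid E] {B : Set E} (hB : B.Finite) (k : ℕ) :
    (∑ _ ∈ range k, B).Finite := by
  induction k with
  | zero => exact Set.finite_zero
  | succ k ih =>
    rw [Finset.sum_range_succ]
    exact ih.add hB

theorem sum_nsmul_mem_sum_const {ι E : Type*} [AddCommMonoid E] {B : Set E} {p : ι → E}
    (hp : ∀ i, p i ∈ B) (s : Finset ι) (N : ι → ℕ) :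
    ∑ i ∈ s, N i • p i ∈ ∑ _ ∈ range (∑ i ∈ s, N i), B := by
  rw [Finset.sum_const, Finset.card_range, ← Finset.sum_nsmul_assoc]
  exact Set.finsetSum_mem_finsetSum _ _ _ fun i _ => Set.nsmul_mem_nsmul (hp i)

variable {E : Type*} [AddCommGroup E] [Module ℝ E]

theorem sum_card_finsuppAntidiag_le_ncard_add {ι : Type*} [Fintype ι] [LinearOrder ι] {p : ι → E}
    {A : Finset E} {l : E → ι → ℝ} {T : E → Finset ι} (h : ∀ a ∈ A, IsCarrier p a (l a) (T a))
    (k : ℕ) :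
    ∑ a ∈ A, #((T a).finsuppAntidiag k) ≤
      ((A : Set E) + ∑ _ ∈ range k, Set.range p).ncard := by
  rw [← Finset.card_sigma, ← Set.ncard_coe_finset]
  refine Set.ncard_le_ncard_of_injOn (fun x => x.1 + ∑ i, x.2 i • p i) ?_ ?_
    (A.finite_toSet.add (finite_sum_const (Set.finite_range p) k))
  · rintro ⟨a, N⟩ hx
    obtain ⟨ha, hN⟩ := Finset.mem_sigma.1 (Finset.mem_coe.1 hx)
    rw [← sum_eq_of_mem_finsuppAntidiag hN]
    exact Set.add_mem_add ha (sum_nsmul_mem_sum_const Set.mem_range_self _ N)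
  · rintro ⟨a, N⟩ hx ⟨b, N'⟩ hy hxy
    obtain ⟨ha, hN⟩ := Finset.mem_sigma.1 (Finset.mem_coe.1 hx)
    obtain ⟨hb, hN'⟩ := Finset.mem_sigma.1 (Finset.mem_coe.1 hy)
    obtain ⟨rfl, rfl⟩ := (h a ha).eq_of_add_eq (h b hb) hN hN' hxy
    rfl

theorem card_mul_choose_le {n : ℕ} {p : Fin n → E} {m : Fin n}
    (hm : AffineIndependent ℝ fun i : Set.Iic m => p i) {A : Finset E}
    (hA : (A : Set E) ⊆ convexHull ℝ (Set.range p)) (k : ℕ) :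
    #A * (m + k).choose k ≤
      ((A : Set E) + ∑ _ ∈ range k, Set.range p).ncard + k * (m + k).choose (k + 1) := by
  have : Nonempty (Fin n) := ⟨m⟩
  choose! l T u hcarrier hcard hu using fun a (ha : a ∈ A) => exists_isCarrier hm (hA ha)
  have hmono : Monotone fun j => (j + k).choose k :=
    fun i j hij => Nat.choose_le_choose k (Nat.add_le_add_right hij k)
  have hinj : Set.InjOn (fun a => (u a : ℕ)) {a ∈ A | (u a : ℕ) < m} := fun a ha b hb hab => by
    rw [← hu a ha.1 ha.2, Fin.ext hab, hu b hb.1 hb.2]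
  have hchoose : ∀ a ∈ A, (min (u a : ℕ) m + k).choose k ≤ #((T a).finsuppAntidiag k) := by
    intro a ha
    rw [Finset.card_finsuppAntidiag_nat_eq_choose]
    have hT : min (u a : ℕ) m + 1 ≤ #(T a) := by
      simpa only [Fin.card_Iic, Fin.coe_min] using hcard a ha
    exact Nat.choose_le_choose k (by omega)
  calc #A * (m + k).choose k
      ≤ ∑ a ∈ A, (min (u a : ℕ) m + k).choose k +
          ∑ j ∈ range m, ((m + k).choose k - (j + k).choose k) := card_mul_le_sum_min_add hmono hinj
    _ ≤ _ := by
      rw [sum_range_choose_sub_choose]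
      gcongr
      exact (Finset.sum_le_sum hchoose).trans (sum_card_finsuppAntidiag_le_ncard_add hcarrier k)

end Counting

section Enumeration

variable {E : Type*} [AddCommGroup E] [Module ℝ E]

theorem exists_affineIndependent_fin {B : Set E} (hB : B.Finite) (hne : B.Nonempty) :
    ∃ b : Fin (Module.finrank ℝ (vectorSpan ℝ B) + 1) → E,
      AffineIndependent ℝ b ∧ Set.range b ⊆ B := by
  obtain ⟨t, htB, hspan, ht⟩ := exists_affineIndependent ℝ E B
  have := (hB.subset htB).fintype
  have htne : t.Nonempty := by rwa [← affineSpan_nonempty ℝ, hspan, affineSpan_nonempty]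
  have := htne.to_subtype
  have hcard : Fintype.card t = Module.finrank ℝ (vectorSpan ℝ B) + 1 := by
    rw [← ht.finrank_vectorSpan_add_one, Subtype.range_coe, ← direction_affineSpan, hspan,
      direction_affineSpan]
  let e := Fintype.equivFinOfCardEq hcard
  exact ⟨fun i => e.symm i, ht.comp_embedding e.symm.toEmbedding,
    Set.range_subset_iff.2 fun i => htB (e.symm i).2⟩

theorem affineIndependent_append_Iic {d n : ℕ} {b : Fin (d + 1) → E} (hb : AffineIndependent ℝ b)
    (f : Fin n → E) :
    AffineIndependent ℝ fun i : Set.Iic (Fin.castAdd n (Fin.last d)) => Fin.append b f i := by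
  let e (i : Set.Iic (Fin.castAdd n (Fin.last d))) : Fin (d + 1) :=
    (i : Fin (d + 1 + n)).castLT (Nat.lt_succ_of_le i.2)
  have he : Function.Injective e := fun i j h => Subtype.ext (Fin.ext (Fin.mk.inj h))
  convert hb.comp_embedding ⟨e, he⟩ using 2 with i
  exact Fin.append_left b f (e i)

theorem exists_enumeration_affineIndependent {B : Set E} (hB : B.Finite) (hne : B.Nonempty) :
    ∃ (n : ℕ) (p : Fin n → E) (m : Fin n), Set.range p = B ∧
      AffineIndependent ℝ (fun i : Set.Iic m => p i) ∧
      (m : ℕ) = Module.finrank ℝ (vectorSpan ℝ B) := by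
  obtain ⟨b, hb, hbB⟩ := exists_affineIndependent_fin hB hne
  obtain ⟨n, f, -, rfl⟩ := hB.fin_param
  refine ⟨_, Fin.append b f, Fin.castAdd n (Fin.last _), ?_, affineIndependent_append_Iic hb f, rfl⟩
  calc Set.range (Fin.append b f) = Set.range (Fin.append b f ∘ finSumFinEquiv) :=
        (finSumFinEquiv.surjective.range_comp _).symm
    _ = Set.range (Sum.elim b f) := congrArg Set.range Fin.append_comp_sumElim
    _ = Set.range f := by rw [Set.Sum.elim_range, Set.union_eq_right.2 hbB]

end Enumeration

theorem mul_choose_sub_mul_choose_succ (d m k : ℕ) :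
    (m : ℝ) * ((d + k).choose k : ℝ) - (k : ℝ) * ((d + k).choose (k + 1) : ℝ) =
      ((m : ℝ) - (k : ℝ) * (d : ℝ) / ((k : ℝ) + 1)) * ((d + k).choose k : ℝ) := by
  have h := Nat.choose_succ_right_eq (d + k) k
  rw [Nat.add_sub_cancel] at h
  have hmul : ((d + k).choose (k + 1) : ℝ) * (k + 1) = (d + k).choose k * d := by exact_mod_cast h
  have hk : (k : ℝ) + 1 ≠ 0 := by positivity
  field_simp
  linear_combination (-(k : ℝ)) * hmul

theorem theorem4_general {E : Type*} [AddCommGroup E] [Module ℝ E] (d m k : ℕ) (A B : Set E)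
    (hA : A.Finite) (hB : B.Finite) (hm : A.ncard = m)
    (hd : Module.finrank ℝ (vectorSpan ℝ B) = d) (hAB : A ⊆ convexHull ℝ B) :
    ((A + ∑ _ ∈ range k, B).ncard : ℝ) ≥
        (m : ℝ) * ((d + k).choose k : ℝ) - (k : ℝ) * ((d + k).choose (k + 1) : ℝ) ∧
      (m : ℝ) * ((d + k).choose k : ℝ) - (k : ℝ) * ((d + k).choose (k + 1) : ℝ) =
        ((m : ℝ) - (k : ℝ) * (d : ℝ) / ((k : ℝ) + 1)) * ((d + k).choose k : ℝ) := by
  refine ⟨?_, mul_choose_sub_mul_choose_succ d m k⟩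
  suffices h : m * (d + k).choose k ≤
      (A + ∑ _ ∈ range k, B).ncard + k * (d + k).choose (k + 1) by
    rw [ge_iff_le, sub_le_iff_le_add]
    exact_mod_cast h
  rcases B.eq_empty_or_nonempty with rfl | hne
  · rw [convexHull_empty, Set.subset_empty_iff] at hAB
    simp [← hm, hAB]
  · lift A to Finset E using hA
    obtain ⟨n, p, i, rfl, hi, hid⟩ := exists_enumeration_affineIndependent hB hne
    rw [← hm, Set.ncard_coe_finset, ← hd, ← hid]
    exact card_mul_choose_le hi hAB k

theorem iteratedSumset_eq_sum {d : ℕ} (B : Set (EuclideanSpace ℝ (Fin d))) (k : ℕ) :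
    iteratedSumset B k = ∑ _ ∈ range k, B := by
  induction k with
  | zero => rfl
  | succ k ih => rw [iteratedSumset, ih, Finset.sum_range_succ]

theorem IsProperDimensional.finrank_vectorSpan {d : ℕ} {B : Set (EuclideanSpace ℝ (Fin d))}
    (hB : IsProperDimensional B) : Module.finrank ℝ (vectorSpan ℝ B) = d := by
  suffices h : vectorSpan ℝ B = ⊤ by rw [h, finrank_top, finrank_euclideanSpace_fin]
  by_contra htop
  obtain ⟨f, hf, hker⟩ := Submodule.exists_le_ker_of_lt_top _ (lt_top_iff_ne_top.2 htop)
  have hconst : ∀ x ∈ B, ∀ y ∈ B, f x = f y := fun x hx y hy =>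
    sub_eq_zero.1 (by rw [← map_sub]; exact hker (vsub_mem_vectorSpan ℝ hx hy))
  rcases B.eq_empty_or_nonempty with rfl | ⟨y, hy⟩
  · exact hB _ ⟨f, hf, 0, rfl⟩ (Set.empty_subset _)
  · exact hB _ ⟨f, hf, f y, rfl⟩ fun x hx => hconst x hx y hy

theorem theorem4 (d m k : ℕ) (hk : 0 < k) (A B : Set (EuclideanSpace ℝ (Fin d)))
    (hA : A.Finite) (hB : B.Finite) (hm : A.ncard = m)
    (hBd : IsProperDimensional B) (hAB : A ⊆ convexHull ℝ B) :
    ((A + iteratedSumset B k).ncard : ℝ) ≥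
        (m : ℝ) * ((d + k).choose k : ℝ) - (k : ℝ) * ((d + k).choose (k + 1) : ℝ) ∧
      (m : ℝ) * ((d + k).choose k : ℝ) - (k : ℝ) * ((d + k).choose (k + 1) : ℝ) =
        ((m : ℝ) - (k : ℝ) * (d : ℝ) / ((k : ℝ) + 1)) * ((d + k).choose k : ℝ) := by
  rw [iteratedSumset_eq_sum]
  exact theorem4_general d m k A B hA hB hm hBd.finrank_vectorSpan hAB
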